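/- For complex numbers $a,q$ put $(a;q)_n=\prod_{i=0}^{n-1}(1-aq^i)$ for integers $n\ge 0$ and, if $|q|<1$, $(a;q)_\infty=\lim_{n\to\infty}(a;q)_n$. For $0<|q|<1$ and $z\ne 0$ put $$Q(q,z)=(q;q)_\infty\,(-z;q)_\infty\,(-q/z;q)_\infty\,(q/z^2;q^2)_\infty\,(z^2q;q^2)_\infty .$$ Let $q\in\mathbb{C}$ with $0<|q|<1$, let $\tilde q=q^2$, and write $(\tilde q)_n=(\tilde q;\tilde q)_n$ for $0\le n\le\infty$. Then for every integer $v\ge 1$, $$\sum_{n_1,\ldots,n_v\ge 0}\frac{\tilde q^{\,\sum_{i=1}^v N_i(N_i+1)+n_v}}{(\tilde q)_{n_1}\cdots(\tilde q)_{n_{v-1}}\,(\tilde q)_{2n_v+1}}\cdot\frac{(q^3;q^6)_{n_v}}{(q;q^2)_{n_v}}=\frac{Q(q^{12v+6},q^{4v+3})}{(\tilde q)_\infty},$$ where $N_i=n_i+n_{i+1}+\cdots+n_v$ for $1\le i\le v$, and the $v$-fold series converges absolutely. In particular (the case $v=1$, item (125) on Slater's list), $$\sum_{n\ge 0}\frac{\tilde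 q^{\,n(n+2)}}{(\tilde q)_{2n+1}}\cdot\frac{(q^3;q^6)_n}{(q;q^2)_n}=\frac{Q(q^{18},q^7)}{(\tilde q)_\infty},$$ with absolute convergence. -/

import Mathlib

open Filter Topology

/-- The finite `q`-Pochhammer symbol `(a; q)_n = (1 - a) (1 - a q) ⋯ (1 - a q ^ (n - 1))`. -/
def qPoch (a q : ℂ) (n : ℕ) : ℂ :=
  ∏ i ∈ Finset.range n, (1 - a * q ^ i)

/-- The infinite `q`-Pochhammer symbol `(a; q)_∞ = lim_{n → ∞} (a; q)_n`, used for `‖q‖ < 1`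
(where the limit exists, see `tendsto_qPoch`). -/
noncomputable def qPochInf (a q : ℂ) : ℂ :=
  limUnder atTop (fun n : ℕ => qPoch a q n)

/-- For `‖q‖ < 1` the limit that defines `(a; q)_∞` exists. -/
theorem tendsto_qPoch (a q : ℂ) (hq : ‖q‖ < 1) :
    Tendsto (fun n : ℕ => qPoch a q n) atTop (𝓝 (qPochInf a q)) := by
  have hs : Summable (fun i : ℕ => ‖-(a * q ^ i)‖) := by
    simpa [norm_mul, norm_pow] using
      (summable_geometric_of_lt_one (norm_nonneg q) hq).mul_left ‖a‖
  have hm := (multipliable_one_add_of_summable hs).hasProd.tendsto_prod_nat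
  have h : Tendsto (fun n : ℕ => qPoch a q n) atTop (𝓝 (∏' i : ℕ, (1 + -(a * q ^ i)))) := by
    simpa only [qPoch, sub_eq_add_neg] using hm
  exact tendsto_nhds_limUnder ⟨_, h⟩

/-- The quintuple product
`Q(q, z) = (q, -z, -q/z; q)_∞ (q/z², z² q; q²)_∞`, for `‖q‖ < 1` and `z ≠ 0`. -/
noncomputable def quintQ (q z : ℂ) : ℂ :=
  (qPochInf q q * qPochInf (-z) q * qPochInf (-(q / z)) q) *
    (qPochInf (q / z ^ 2) (q ^ 2) * qPochInf (z ^ 2 * q) (q ^ 2))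

/-- The tail sums `N_i = n_i + n_{i+1} + ⋯ + n_v`; the indices `1, …, v` are represented by
`Fin v`. -/
def tailSum {v : ℕ} (n : Fin v → ℕ) (i : Fin v) : ℕ :=
  ∑ j ∈ Finset.Ici i, n j

/-! With `p = q ^ 2`, the series is the output of a Bailey chain, and the bilateral theta series it
produces is summed by the quintuple product identity. Bailey pairs relative to `a = p` are written
bilaterally: `β n = ∑ α r / ((p)_{n-r} (p)_{n+r+1})`, with `r` running over all integers. By
q-Vandermonde, replacing `β` by `∑ p^(j²+j) β j / (p)_{N-j}` multiplies `α r` by `p^(r²+r)`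
(`sum_antidiagonal_baileyKernel`). Each step contributes one summation index; a last step and `N →
∞` give `∑ α r p^(v(r²+r)) / (p)_∞` for the `v`-fold series (`hasSum_chainTerm`). The cubic factor
`(q^3; q^6)_n / (q; q^2)_n` comes from the finite Jacobi triple product at `z = exp(πi/3)`, since
`(1 + zy)(1 + y/z) = 1 + y + y² = (1 - y³)/(1 - y)`. It yields the pair with `α r = e(r) q^(r²+2r)`,
`e` of period 6 (`tsum_hexSign_mul_baileyKernel`). As `e` vanishes on `r ≡ 2 mod 3`, the classes `r
= 3k, 3k + 1` combine into the quintuple product series (`tsum_hexSign_eq_quintQ`). That identity is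
the limit of a finite form proved by telescoping (`tsum_quintTerm`, `tsum_eq_quintQ`). -/

/-! ### Reciprocal q-Pochhammer symbols with integer index -/

/-- The reciprocal `1 / (a; q)_j` of the `q`-Pochhammer symbol, for an integer index `j`; for
`j = -m < 0` it is `(a q ^ (-m); q)_m`. -/
noncomputable def qPochInv (a q : ℂ) : ℤ → ℂ
  | Int.ofNat n => (qPoch a q n)⁻¹
  | Int.negSucc n => ∏ i ∈ Finset.range (n + 1), (1 - a / q ^ (i + 1))

theorem qPochInv_natCast (a q : ℂ) (n : ℕ) : qPochInv a q n = (qPoch a q n)⁻¹ := rfl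

@[simp] theorem qPoch_zero (a q : ℂ) : qPoch a q 0 = 1 := by simp [qPoch]

theorem qPoch_succ (a q : ℂ) (n : ℕ) : qPoch a q (n + 1) = qPoch a q n * (1 - a * q ^ n) := by
  simp [qPoch, Finset.prod_range_succ]

@[simp] theorem qPochInv_zero (a q : ℂ) : qPochInv a q 0 = 1 := by
  simpa using qPochInv_natCast a q 0

/-- Having one recurrence at all integers, with no boundary cases, is what the integer-indexed
reciprocal is for: sums over `ℤ` can be shifted freely. -/
theorem qPochInv_sub_one {a q : ℂ} (h : ∀ n : ℕ, 1 - a * q ^ n ≠ 0) (j : ℤ) :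
    qPochInv a q (j - 1) = (1 - a * q ^ (j - 1)) * qPochInv a q j := by
  rcases j with n | n
  · rcases n with _ | n
    · have : qPochInv a q (-1) = 1 - a / q := by
        change qPochInv a q (Int.negSucc 0) = _
        simp [qPochInv]
      simp [this, div_eq_mul_inv]
    · have e : Int.ofNat (n + 1) - 1 = (n : ℤ) := by simp
      rw [e, qPochInv_natCast]
      change _ = _ * (qPoch a q (n + 1))⁻¹
      rw [qPoch_succ, mul_inv, zpow_natCast]
      field_simp [h n]
  · have e : Int.negSucc n - 1 = Int.negSucc (n + 1) := by
      simp only [Int.negSucc_eq]; push_cast; ring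
    rw [e, zpow_negSucc]
    simp only [qPochInv]
    rw [Finset.prod_range_succ _ (n + 1), div_eq_mul_inv, mul_comm]

theorem one_sub_pow_ne_zero {q : ℂ} (hq : ‖q‖ < 1) {n : ℕ} (hn : n ≠ 0) : 1 - q ^ n ≠ 0 := by
  intro h
  have h1 : ‖q ^ n‖ < 1 := by rw [norm_pow]; exact pow_lt_one₀ (norm_nonneg _) hq hn
  rw [← sub_eq_zero.mp h] at h1
  simp at h1

theorem one_sub_zpow_ne_zero {q : ℂ} (hq : ‖q‖ < 1) {n : ℤ} (hn : n ≠ 0) :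
    1 - q ^ n ≠ 0 := by
  obtain ⟨m, rfl | rfl⟩ := n.eq_nat_or_neg
  · rw [zpow_natCast]
    exact one_sub_pow_ne_zero hq (by simpa using hn)
  · have hm : 1 - q ^ m ≠ 0 := one_sub_pow_ne_zero hq (by simpa using hn)
    rw [zpow_neg, zpow_natCast]
    intro h
    apply hm
    have : (q ^ m)⁻¹ = 1 := (sub_eq_zero.mp h).symm
    rw [inv_eq_one.mp this, sub_self]

theorem qPochInf_eq_tprod {q : ℂ} (a : ℂ) (hq : ‖q‖ < 1) :
    qPochInf a q = ∏' i : ℕ, (1 + -(a * q ^ i)) := by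
  have hs : Summable (fun i : ℕ => ‖-(a * q ^ i)‖) := by
    simpa [norm_mul, norm_pow] using
      (summable_geometric_of_lt_one (norm_nonneg q) hq).mul_left ‖a‖
  refine tendsto_nhds_unique (tendsto_qPoch a q hq) ?_
  simpa only [qPoch, sub_eq_add_neg] using
    (multipliable_one_add_of_summable hs).hasProd.tendsto_prod_nat

theorem qPochInf_ne_zero {a q : ℂ} (hq : ‖q‖ < 1) (h : ∀ n : ℕ, 1 - a * q ^ n ≠ 0) :
    qPochInf a q ≠ 0 := by
  rw [qPochInf_eq_tprod a hq]
  refine tprod_one_add_ne_zero_of_summable (fun i => ?_) ?_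
  · simpa [sub_eq_add_neg] using h i
  · simpa [norm_mul, norm_pow] using
      (summable_geometric_of_lt_one (norm_nonneg q) hq).mul_left ‖a‖

theorem qPoch_ne_zero {a q : ℂ} (h : ∀ n : ℕ, 1 - a * q ^ n ≠ 0) (n : ℕ) : qPoch a q n ≠ 0 :=
  Finset.prod_ne_zero_iff.mpr fun i _ => h i

theorem tendsto_qPochInv_natCast {a q : ℂ} (hq : ‖q‖ < 1) (h : ∀ n : ℕ, 1 - a * q ^ n ≠ 0) :
    Tendsto (fun n : ℕ => qPochInv a q n) atTop (𝓝 (qPochInf a q)⁻¹) := by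
  simpa only [qPochInv_natCast] using (tendsto_qPoch a q hq).inv₀ (qPochInf_ne_zero hq h)

theorem tendsto_qPochInv_add {a q : ℂ} (hq : ‖q‖ < 1) (h : ∀ n : ℕ, 1 - a * q ^ n ≠ 0) (s : ℤ) :
    Tendsto (fun n : ℕ => qPochInv a q ((n : ℤ) + s)) atTop (𝓝 (qPochInf a q)⁻¹) := by
  have h1 : Tendsto (fun n : ℕ => ((n : ℤ) + s).toNat) atTop atTop := by
    refine tendsto_atTop.mpr fun b => ?_
    filter_upwards [eventually_ge_atTop (b + s.natAbs)] with n hn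
    omega
  refine ((tendsto_qPochInv_natCast hq h).comp h1).congr' ?_
  filter_upwards [eventually_ge_atTop s.natAbs] with n hn
  simp only [Function.comp]
  congr 1
  omega

theorem exists_norm_qPochInv_le {a q : ℂ} (hq : ‖q‖ < 1) (h : ∀ n : ℕ, 1 - a * q ^ n ≠ 0) :
    ∃ C : ℝ, 1 ≤ C ∧ ∀ j : ℤ, 0 ≤ j → ‖qPochInv a q j‖ ≤ C := by
  obtain ⟨C, hC⟩ := (Metric.isBounded_range_of_tendsto _
    (tendsto_qPochInv_natCast hq h)).exists_norm_le
  refine ⟨max 1 C, le_max_left _ _, fun j hj => ?_⟩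
  lift j to ℕ using hj
  exact (hC _ ⟨j, rfl⟩).trans (le_max_right _ _)

/-- For `a = q` the reciprocal vanishes at the negative integers. -/
theorem qPochInv_self_of_neg {q : ℂ} (hq : q ≠ 0) {j : ℤ} (hj : j < 0) : qPochInv q q j = 0 := by
  obtain ⟨n, rfl⟩ := Int.eq_negSucc_of_lt_zero hj
  exact Finset.prod_eq_zero (Finset.mem_range.mpr n.succ_pos) (by simp [hq])

theorem one_sub_self_mul_pow_ne_zero {q : ℂ} (hq : ‖q‖ < 1) (n : ℕ) : 1 - q * q ^ n ≠ 0 := by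
  rw [← pow_succ']
  exact one_sub_pow_ne_zero hq n.succ_ne_zero

theorem qPochInv_self_sub_one {q : ℂ} (h0 : q ≠ 0) (hq : ‖q‖ < 1) (j : ℤ) :
    qPochInv q q (j - 1) = (1 - q ^ j) * qPochInv q q j := by
  rw [qPochInv_sub_one (one_sub_self_mul_pow_ne_zero hq), ← zpow_one_add₀ h0]
  congr 3
  ring

theorem exists_norm_qPochInv_self_le {q : ℂ} (h0 : q ≠ 0) (hq : ‖q‖ < 1) :
    ∃ C : ℝ, 1 ≤ C ∧ ∀ j : ℤ, ‖qPochInv q q j‖ ≤ C := by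
  obtain ⟨C, hC, h⟩ := exists_norm_qPochInv_le hq (one_sub_self_mul_pow_ne_zero hq)
  refine ⟨C, hC, fun j => ?_⟩
  rcases lt_or_ge j 0 with hj | hj
  · rw [qPochInv_self_of_neg h0 hj, norm_zero]; linarith
  · exact h j hj

/-- Summability of a function on `ℤ` that vanishes outside an interval. -/
theorem summable_int_of_support {f : ℤ → ℂ} (a b : ℤ) (h : ∀ k, k < a ∨ b < k → f k = 0) :
    Summable f :=
  summable_of_ne_finset_zero (s := Finset.Icc a b) fun k hk => h k (by
    rw [Finset.mem_Icc] at hk; omega)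

theorem tsum_int_shift (f : ℤ → ℂ) (s : ℤ) : ∑' k : ℤ, f (k + s) = ∑' k : ℤ, f k :=
  (Equiv.addRight s).tsum_eq f

theorem qPochInf_sq_sq {a q : ℂ} (hq : ‖q‖ < 1) :
    qPochInf (a ^ 2) (q ^ 2) = qPochInf a q * qPochInf (-a) q := by
  have hq2 : ‖q ^ 2‖ < 1 := by rw [norm_pow]; exact pow_lt_one₀ (norm_nonneg _) hq two_ne_zero
  refine tendsto_nhds_unique (tendsto_qPoch _ _ hq2) ?_
  refine ((tendsto_qPoch a q hq).mul (tendsto_qPoch (-a) q hq)).congr fun n => ?_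
  simp only [qPoch, ← Finset.prod_mul_distrib]
  refine Finset.prod_congr rfl fun i _ => ?_
  ring

theorem qPochInf_eq_mul_sq {a q : ℂ} (hq : ‖q‖ < 1) :
    qPochInf a q = qPochInf a (q ^ 2) * qPochInf (a * q) (q ^ 2) := by
  have hq2 : ‖q ^ 2‖ < 1 := by rw [norm_pow]; exact pow_lt_one₀ (norm_nonneg _) hq two_ne_zero
  have h2 : Tendsto (fun n : ℕ => 2 * n) atTop atTop :=
    tendsto_id.const_mul_atTop' (by norm_num)
  refine tendsto_nhds_unique ((tendsto_qPoch a q hq).comp h2) ?_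
  refine ((tendsto_qPoch a (q ^ 2) hq2).mul (tendsto_qPoch (a * q) (q ^ 2) hq2)).congr fun n => ?_
  simp only [Function.comp]
  induction n with
  | zero => simp
  | succ n ih =>
    rw [qPoch_succ, qPoch_succ, show 2 * (n + 1) = 2 * n + 1 + 1 by ring, qPoch_succ, qPoch_succ,
      ← ih]
    ring

/-! ### q-Vandermonde and the limiting Bailey lemma -/

/-- A form of the `q`-Vandermonde summation. -/
theorem tsum_qPochInv_vandermonde {p : ℂ} (h0 : p ≠ 0) (hp : ‖p‖ < 1) (M : ℕ) (s : ℤ) :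
    ∑' m : ℤ, p ^ (m * (m + s)) * qPochInv p p (M - m) * qPochInv p p m * qPochInv p p (m + s) =
      qPochInv p p M * qPochInv p p (M + s) := by
  have hz : ∀ j : ℤ, j < 0 → qPochInv p p j = 0 := fun j => qPochInv_self_of_neg h0
  have hr := qPochInv_self_sub_one h0 hp
  induction M generalizing s with
  | zero =>
    rw [tsum_eq_single 0]
    · simp
    · intro m hm
      rcases lt_or_gt_of_ne hm with h | h
      · rw [hz m h]; ring
      · rw [hz _ (by push_cast; omega)]; ring
  | succ M ih =>
    have hne : 1 - p ^ ((M : ℤ) + 1) ≠ 0 := one_sub_zpow_ne_zero hp (by omega)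
    refine mul_left_cancel₀ hne ?_
    have hS1 : Summable fun m : ℤ => p ^ (m * (m + s)) * qPochInv p p (M - m) * qPochInv p p m *
        qPochInv p p (m + s) := summable_int_of_support 0 M fun k hk => by
      rcases hk with h | h
      · rw [hz k h]; ring
      · rw [hz _ (by omega : (M : ℤ) - k < 0)]; ring
    have hS2 : Summable fun m : ℤ => p ^ ((M : ℤ) + 1 + s) * (p ^ (m * (m + (s + 1))) *
        qPochInv p p (M - m) * qPochInv p p m * qPochInv p p (m + (s + 1))) :=
      summable_int_of_support 0 M fun k hk => by
      rcases hk with h | h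
      · rw [hz k h]; ring
      · rw [hz _ (by omega : (M : ℤ) - k < 0)]; ring
    have hS3 : Summable fun m : ℤ => p ^ ((M : ℤ) + 1 + s) * (p ^ ((m - 1) * (m - 1 + (s + 1))) *
        qPochInv p p (M - (m - 1)) * qPochInv p p (m - 1) * qPochInv p p (m - 1 + (s + 1))) :=
      (Equiv.subRight (1 : ℤ)).summable_iff.mpr hS2
    -- Split `1 - p^(M+1) = (1 - p^(M+1-m)) + p^(M+1-m) (1 - p^m)`. Each bracket lowers the index of
    -- one reciprocal, giving the sums for `(M, s)` and, after `m ↦ m + 1`, for `(M, s + 1)`.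
    have hterm : ∀ m : ℤ, (1 - p ^ ((M : ℤ) + 1)) * (p ^ (m * (m + s)) *
        qPochInv p p ((M + 1 : ℕ) - m) * qPochInv p p m * qPochInv p p (m + s)) =
        p ^ (m * (m + s)) * qPochInv p p (M - m) * qPochInv p p m * qPochInv p p (m + s) +
        p ^ ((M : ℤ) + 1 + s) * (p ^ ((m - 1) * ((m - 1) + (s + 1))) *
        qPochInv p p (M - (m - 1)) * qPochInv p p (m - 1) *
          qPochInv p p ((m - 1) + (s + 1))) := fun m => by
      have e1 : ((M + 1 : ℕ) : ℤ) - m = (M : ℤ) + 1 - m := by push_cast; ring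
      have e2 : (M : ℤ) - m = (M : ℤ) + 1 - m - 1 := by ring
      have e3 : (M : ℤ) - (m - 1) = (M : ℤ) + 1 - m := by ring
      have e4 : m - 1 + (s + 1) = m + s := by ring
      have e5 : p ^ ((M : ℤ) + 1 + s) * p ^ ((m - 1) * (m + s)) =
          p ^ (m * (m + s)) * p ^ ((M : ℤ) + 1 - m) := by
        rw [← zpow_add₀ h0, ← zpow_add₀ h0]; congr 1; ring
      have e6 : p ^ ((M : ℤ) + 1) = p ^ ((M : ℤ) + 1 - m) * p ^ m := by
        rw [← zpow_add₀ h0]; congr 1; ring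
      rw [e1, e2, e3, e4, hr, hr, e6]
      linear_combination (-(qPochInv p p (↑M + 1 - m) * ((1 - p ^ m) * qPochInv p p m) *
        qPochInv p p (m + s))) * e5
    rw [← tsum_mul_left, tsum_congr hterm, hS1.tsum_add hS3]
    have e := tsum_int_shift (fun m : ℤ => p ^ ((M : ℤ) + 1 + s) * (p ^ (m * (m + (s + 1))) *
        qPochInv p p (M - m) * qPochInv p p m * qPochInv p p (m + (s + 1)))) (-1)
    simp only [← sub_eq_add_neg] at e
    rw [ih s, e, tsum_mul_left, ih (s + 1)]
    have e7 : ((M : ℤ) + s) = (M : ℤ) + 1 + s - 1 := by ring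
    have e8 : ((M : ℤ) + (s + 1)) = (M : ℤ) + 1 + s := by ring
    have e10 : qPochInv p p (M : ℤ) = (1 - p ^ ((M : ℤ) + 1)) * qPochInv p p ((M : ℤ) + 1) := by
      rw [← hr, add_sub_cancel_right]
    rw [e8, e7, hr, e10]
    push_cast
    ring

/-- The Bailey kernel `1 / ((p; p)_{n-r} (p; p)_{n+r+1})`. -/
noncomputable def baileyKernel (p : ℂ) (r n : ℤ) : ℂ :=
  qPochInv p p (n - r) * qPochInv p p (n + r + 1)

theorem baileyKernel_eq_zero {p : ℂ} (h0 : p ≠ 0) {r n : ℤ} (h : r < -n - 1 ∨ n < r) :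
    baileyKernel p r n = 0 := by
  unfold baileyKernel
  rcases h with h | h
  · rw [qPochInv_self_of_neg h0 (by omega : n + r + 1 < 0), mul_zero]
  · rw [qPochInv_self_of_neg h0 (by omega : n - r < 0), zero_mul]

theorem baileyKernel_eq_zero_of_neg {p : ℂ} (h0 : p ≠ 0) {r n : ℤ} (h : n < 0) :
    baileyKernel p r n = 0 := by
  unfold baileyKernel
  rcases lt_or_ge n r with h | h
  · rw [qPochInv_self_of_neg h0 (by omega : n - r < 0), zero_mul]
  · rw [qPochInv_self_of_neg h0 (by omega : n + r + 1 < 0), mul_zero]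

/-- The limiting case of Bailey's lemma, for the kernel. -/
theorem sum_antidiagonal_baileyKernel {p : ℂ} (h0 : p ≠ 0) (hp : ‖p‖ < 1) (r : ℤ) (N : ℕ) :
    ∑ x ∈ Finset.HasAntidiagonal.antidiagonal N,
        qPochInv p p x.1 * (p ^ (x.2 ^ 2 + x.2) * baileyKernel p r x.2) =
      p ^ (r ^ 2 + r) * baileyKernel p r N := by
  have key : ∑' j : ℤ, qPochInv p p (N - j) * (p ^ (j ^ 2 + j) * baileyKernel p r j) =
      p ^ (r ^ 2 + r) * baileyKernel p r N := by
    -- With `j = m + r`, `j² + j = (r² + r) + m (m + 2r + 1)`: this is the Vandermonde sum with `M =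
    -- N - r` and `s = 2r + 1`.
    rw [← tsum_int_shift _ r]
    have h : ∀ m : ℤ, qPochInv p p (N - (m + r)) *
        (p ^ ((m + r) ^ 2 + (m + r)) * baileyKernel p r (m + r)) =
        p ^ (r ^ 2 + r) * (p ^ (m * (m + (2 * r + 1))) * qPochInv p p ((N : ℤ) - r - m) *
          qPochInv p p m * qPochInv p p (m + (2 * r + 1))) := fun m => by
      have e1 : p ^ ((m + r) ^ 2 + (m + r)) = p ^ (r ^ 2 + r) * p ^ (m * (m + (2 * r + 1))) := by
        rw [← zpow_add₀ h0]; congr 1; ring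
      have e2 : (N : ℤ) - (m + r) = N - r - m := by ring
      have e3 : m + r - r = m := by ring
      have e4 : m + r + r + 1 = m + (2 * r + 1) := by ring
      rw [baileyKernel, e1, e2, e3, e4]
      ring
    rw [tsum_congr h, tsum_mul_left]
    congr 1
    -- Vandermonde needs a natural upper index; when `N < r` both sides vanish.
    rcases lt_or_ge ((N : ℤ) - r) 0 with hN | hN
    · rw [baileyKernel_eq_zero h0 (Or.inr (by omega))]
      convert tsum_zero with m
      rcases lt_or_ge m 0 with hm | hm
      · rw [qPochInv_self_of_neg h0 hm]; ring
      · rw [qPochInv_self_of_neg h0 (by omega : (N : ℤ) - r - m < 0)]; ring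
    · obtain ⟨M, hM⟩ := Int.eq_ofNat_of_zero_le hN
      rw [hM, tsum_qPochInv_vandermonde h0 hp, baileyKernel, hM]
      congr 2
      omega
  rw [← key, ← Finset.Nat.sum_antidiagonal_swap,
    Finset.Nat.sum_antidiagonal_eq_sum_range_succ_mk,
    tsum_eq_sum (s := (Finset.range (N + 1)).map Nat.castEmbedding), Finset.sum_map]
  · refine Finset.sum_congr rfl fun i hi => ?_
    have hi := Finset.mem_range.mp hi
    have e1 : ((N - i : ℕ) : ℤ) = N - i := by omega
    simp only [Prod.fst_swap, Prod.snd_swap, Nat.castEmbedding_apply, e1]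
    norm_cast
  · intro j hj
    rcases lt_or_ge j 0 with h | h
    · rw [baileyKernel_eq_zero_of_neg h0 h]; ring
    · rw [qPochInv_self_of_neg h0, zero_mul]
      by_contra hc
      apply hj
      lift j to ℕ using h
      simp
      omega

/-! ### The cubic Bailey pair -/

/-- The `6`-periodic sequence `1, 1, 0, -1, -1, 0, …`, the solution of
`e (r - 1) + e (r + 1) = e r` with `e 0 = e 1 = 1`. -/
def hexSign (r : ℤ) : ℂ :=
  if r % 6 = 0 ∨ r % 6 = 1 then 1 else if r % 6 = 3 ∨ r % 6 = 4 then -1 else 0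

theorem hexSign_sub_one_add (r : ℤ) : hexSign (r - 1) + hexSign (r + 1) = hexSign r := by
  have h : r % 6 = 0 ∨ r % 6 = 1 ∨ r % 6 = 2 ∨ r % 6 = 3 ∨ r % 6 = 4 ∨ r % 6 = 5 := by omega
  rcases h with h | h | h | h | h | h <;> simp [hexSign, Int.sub_emod, Int.add_emod, h]

/-- The shifted sequence `e(r - 1)` is odd in `r`, being proportional to `sin(πr/3)`, so it sums to
zero against the even `thetaKernel`. -/
theorem hexSign_neg_sub_one (r : ℤ) : hexSign (-r - 1) = -hexSign (r - 1) := by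
  have h : r % 6 = 0 ∨ r % 6 = 1 ∨ r % 6 = 2 ∨ r % 6 = 3 ∨ r % 6 = 4 ∨ r % 6 = 5 := by omega
  rcases h with h | h | h | h | h | h
  all_goals
    have h1 : (-r - 1) % 6 = 5 - r % 6 := by omega
    have h2 : (r - 1) % 6 = (r % 6 + 5) % 6 := by omega
    simp [hexSign, h1, h2, h]

theorem norm_hexSign_le (r : ℤ) : ‖hexSign r‖ ≤ 1 := by
  unfold hexSign
  split_ifs <;> simp

theorem hexSign_three_mul (k : ℤ) : hexSign (3 * k) = (-1) ^ k := by
  rcases Int.even_or_odd' k with ⟨m, rfl | rfl⟩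
  · have h1 : (3 * (2 * m)) % 6 = 0 := by omega
    simp [hexSign, h1, zpow_mul]
  · have h1 : (3 * (2 * m + 1)) % 6 = 3 := by omega
    simp [hexSign, h1, zpow_mul, zpow_add₀]

theorem hexSign_three_mul_add_one (k : ℤ) : hexSign (3 * k + 1) = (-1) ^ k := by
  rcases Int.even_or_odd' k with ⟨m, rfl | rfl⟩
  · have h1 : (3 * (2 * m) + 1) % 6 = 1 := by omega
    simp [hexSign, h1, zpow_mul]
  · have h1 : (3 * (2 * m + 1) + 1) % 6 = 4 := by omega
    simp [hexSign, h1, zpow_mul, zpow_add₀]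

theorem hexSign_three_mul_add_two (k : ℤ) : hexSign (3 * k + 2) = 0 := by
  have h : (3 * k + 2) % 6 = 2 ∨ (3 * k + 2) % 6 = 5 := by omega
  rcases h with h | h <;> simp [hexSign, h]

/-- The kernel `q ^ (r ^ 2) / ((p; p)_{n-r} (p; p)_{n+r})`, `p = q ^ 2`, of the finite Jacobi
triple product. -/
noncomputable def thetaKernel (q : ℂ) (r n : ℤ) : ℂ :=
  q ^ (r ^ 2) * (qPochInv (q ^ 2) (q ^ 2) (n - r) * qPochInv (q ^ 2) (q ^ 2) (n + r))

theorem thetaKernel_eq_zero {q : ℂ} (h0 : q ≠ 0) {r n : ℤ} (h : r < -n ∨ n < r) :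
    thetaKernel q r n = 0 := by
  have hp : q ^ 2 ≠ 0 := pow_ne_zero 2 h0
  unfold thetaKernel
  rcases h with h | h
  · rw [qPochInv_self_of_neg hp (by omega : n + r < 0)]; ring
  · rw [qPochInv_self_of_neg hp (by omega : n - r < 0)]; ring

theorem thetaKernel_neg (q : ℂ) (r n : ℤ) : thetaKernel q (-r) n = thetaKernel q r n := by
  simp only [thetaKernel, neg_sq, sub_neg_eq_add, ← sub_eq_add_neg]
  ring

theorem norm_sq_lt_one {q : ℂ} (hq : ‖q‖ < 1) : ‖q ^ 2‖ < 1 := by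
  rw [norm_pow]; exact pow_lt_one₀ (norm_nonneg _) hq two_ne_zero

theorem sq_zpow (q : ℂ) (j : ℤ) : (q ^ 2) ^ j = q ^ (2 * j) := by
  rw [zpow_mul]; norm_cast

/-- This compares coefficients of `z^r` when the finite triple product acquires its next factors `(1
+ z q^(2n+1)) (1 + q^(2n+1)/z)`, whose product is `1 + q^(4n+2) + q^(2n+1) (z + 1/z)`. -/
theorem thetaKernel_succ {q : ℂ} (h0 : q ≠ 0) (hq : ‖q‖ < 1) (r n : ℤ) :
    (1 - q ^ (4 * n + 2)) * (1 - q ^ (4 * n + 4)) * thetaKernel q r (n + 1) =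
      (1 + q ^ (4 * n + 2)) * thetaKernel q r n +
        q ^ (2 * n + 1) * (thetaKernel q (r - 1) n + thetaKernel q (r + 1) n) := by
  have hp : q ^ 2 ≠ 0 := pow_ne_zero 2 h0
  have hr := qPochInv_self_sub_one hp (norm_sq_lt_one hq)
  unfold thetaKernel
  have e1 : n - r = n + 1 - r - 1 := by ring
  have e2 : n + r = n + 1 + r - 1 := by ring
  have e3 : n - (r - 1) = n + 1 - r := by ring
  have e4 : n + (r - 1) = n + 1 + r - 1 - 1 := by ring
  have e5 : n - (r + 1) = n + 1 - r - 1 - 1 := by ring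
  have e6 : n + (r + 1) = n + 1 + r := by ring
  rw [e3, e4, e5, e6, e1, e2, hr (n + 1 - r - 1), hr (n + 1 - r),
    hr (n + 1 + r - 1), hr (n + 1 + r)]
  have f1 : q ^ (2 * n + 1) * q ^ ((r - 1) ^ 2) = q ^ (r ^ 2) * (q ^ 2) ^ (n + 1 - r) := by
    rw [sq_zpow, ← zpow_add₀ h0, ← zpow_add₀ h0]; congr 1; ring
  have f2 : q ^ (2 * n + 1) * q ^ ((r + 1) ^ 2) = q ^ (r ^ 2) * (q ^ 2) ^ (n + 1 + r) := by
    rw [sq_zpow, ← zpow_add₀ h0, ← zpow_add₀ h0]; congr 1; ring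
  have f3 : q ^ (4 * n + 4) = (q ^ 2) ^ (n + 1 - r) * (q ^ 2) ^ (n + 1 + r) := by
    rw [← zpow_add₀ hp, sq_zpow]; congr 1; ring
  have f4 : q ^ (4 * n + 2) = (q ^ 2) ^ (n + 1 - r) * (q ^ 2) ^ (n + 1 + r) / q ^ 2 := by
    rw [← zpow_add₀ hp, sq_zpow, eq_div_iff hp, ← zpow_natCast q 2, ← zpow_add₀ h0]
    congr 1; push_cast; ring
  rw [f3, f4, mul_add, ← mul_assoc (q ^ (2 * n + 1)), f1, ← mul_assoc (q ^ (2 * n + 1)), f2,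
    zpow_sub_one₀ hp, zpow_sub_one₀ hp]
  generalize (q ^ 2) ^ (n + 1 - r) = X, (q ^ 2) ^ (n + 1 + r) = Y
  field_simp
  ring

theorem one_sub_mul_sq_pow_ne_zero {q : ℂ} (hq : ‖q‖ < 1) (n : ℕ) : 1 - q * (q ^ 2) ^ n ≠ 0 := by
  rw [← pow_mul, ← pow_succ']
  exact one_sub_pow_ne_zero hq (Nat.succ_ne_zero _)

/-- The finite Jacobi triple product at a primitive cube root of unity. -/
theorem tsum_hexSign_mul_thetaKernel {q : ℂ} (h0 : q ≠ 0) (hq : ‖q‖ < 1) (n : ℕ) :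
    ∑' r : ℤ, hexSign r * thetaKernel q r n =
      qPoch (q ^ 3) (q ^ 6) n / qPoch q (q ^ 2) n * (qPoch (q ^ 2) (q ^ 2) (2 * n))⁻¹ := by
  induction n with
  | zero =>
    rw [tsum_eq_single 0]
    · simp [hexSign, thetaKernel]
    · intro r hr
      rw [thetaKernel_eq_zero h0 (by push_cast; omega), mul_zero]
  | succ n ih =>
    have hz : ∀ {r : ℤ}, r < -n ∨ (n : ℤ) < r → thetaKernel q r n = 0 := thetaKernel_eq_zero h0
    have s0 : Summable fun r : ℤ => hexSign r * thetaKernel q r n :=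
      summable_int_of_support (-n) n fun k hk => by rw [hz hk, mul_zero]
    have s1 : Summable fun r : ℤ => hexSign r * thetaKernel q (r - 1) n :=
      summable_int_of_support (-n + 1) (n + 1) fun k hk => by rw [hz (by omega), mul_zero]
    have s2 : Summable fun r : ℤ => hexSign r * thetaKernel q (r + 1) n :=
      summable_int_of_support (-n - 1) (n - 1) fun k hk => by rw [hz (by omega), mul_zero]
    have s3 : Summable fun r : ℤ => hexSign (r - 1) * thetaKernel q r n :=
      summable_int_of_support (-n) n fun k hk => by rw [hz hk, mul_zero]
    have s4 : Summable fun r : ℤ => hexSign (r + 1) * thetaKernel q r n :=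
      summable_int_of_support (-n) n fun k hk => by rw [hz hk, mul_zero]
    have t1 : ∑' r : ℤ, hexSign r * thetaKernel q (r - 1) n =
        ∑' r : ℤ, hexSign (r + 1) * thetaKernel q r n := by
      rw [← tsum_int_shift _ 1]; simp
    have t2 : ∑' r : ℤ, hexSign r * thetaKernel q (r + 1) n =
        ∑' r : ℤ, hexSign (r - 1) * thetaKernel q r n := by
      rw [← tsum_int_shift (fun r : ℤ => hexSign (r - 1) * thetaKernel q r n) 1]; simp
    -- Moving the shifts from the kernel to `e` turns `z + 1/z` into the operator `e(r-1) + e(r+1)`,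
    -- which acts on `e` as 1.
    have key : (1 - q ^ (4 * n + 2)) * (1 - q ^ (4 * n + 4)) *
        ∑' r : ℤ, hexSign r * thetaKernel q r (n + 1 : ℕ) =
        (1 + q ^ (2 * n + 1) + q ^ (4 * n + 2)) * ∑' r : ℤ, hexSign r * thetaKernel q r n := by
      have h : ∀ r : ℤ, (1 - q ^ (4 * n + 2)) * (1 - q ^ (4 * n + 4)) *
          (hexSign r * thetaKernel q r (n + 1 : ℕ)) =
          (1 + q ^ (4 * n + 2)) * (hexSign r * thetaKernel q r n) + q ^ (2 * n + 1) *
          (hexSign r * thetaKernel q (r - 1) n + hexSign r * thetaKernel q (r + 1) n) := by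
        intro r
        have := thetaKernel_succ h0 hq r n
        norm_cast at this
        push_cast
        push_cast at this
        linear_combination hexSign r * this
      rw [← tsum_mul_left, tsum_congr h, (s0.mul_left _).tsum_add ((s1.add s2).mul_left _),
        tsum_mul_left, tsum_mul_left, s1.tsum_add s2, t1, t2, add_comm (∑' _, _) (∑' _, _),
        ← s3.tsum_add s4]
      simp only [← add_mul, hexSign_sub_one_add]
      ring
    have n1 : 1 - q ^ (4 * n + 2) ≠ 0 := one_sub_pow_ne_zero hq (by omega)
    have n2 : 1 - q ^ (4 * n + 4) ≠ 0 := one_sub_pow_ne_zero hq (by omega)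
    have n3 : 1 - q * (q ^ 2) ^ n ≠ 0 := one_sub_mul_sq_pow_ne_zero hq n
    have n4 : qPoch q (q ^ 2) n ≠ 0 := qPoch_ne_zero (one_sub_mul_sq_pow_ne_zero hq) n
    have n5 : qPoch (q ^ 2) (q ^ 2) (2 * n) ≠ 0 :=
      qPoch_ne_zero (one_sub_self_mul_pow_ne_zero (norm_sq_lt_one hq)) _
    rw [ih] at key
    refine mul_left_cancel₀ (mul_ne_zero n1 n2) (key.trans ?_)
    rw [show 2 * (n + 1) = 2 * n + 1 + 1 by ring]
    simp only [qPoch_succ]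
    have g1 : q ^ 2 * (q ^ 2) ^ (2 * n) = q ^ (4 * n + 2) := by ring
    have g2 : q ^ 2 * (q ^ 2) ^ (2 * n + 1) = q ^ (4 * n + 4) := by ring
    have g3 : 1 - q ^ 3 * (q ^ 6) ^ n =
        (1 + q ^ (2 * n + 1) + q ^ (4 * n + 2)) * (1 - q * (q ^ 2) ^ n) := by ring
    rw [g1, g2, g3]
    field_simp

/-- The sequence `β` of the Bailey pair relative to `q ^ 2` behind the series. -/
noncomputable def cubicBeta (q : ℂ) (n : ℕ) : ℂ :=
  (q ^ 2) ^ n / qPoch (q ^ 2) (q ^ 2) (2 * n + 1) * (qPoch (q ^ 3) (q ^ 6) n / qPoch q (q ^ 2) n)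

/-- Up to the factor `1 - q^(4n+2)`, the weighted Bailey kernel is a combination of `thetaKernel` at
`r` and at `r + 1`. The first part is the finite triple product; the second cancels by parity. -/
theorem tsum_hexSign_mul_baileyKernel {q : ℂ} (h0 : q ≠ 0) (hq : ‖q‖ < 1) (n : ℕ) :
    ∑' r : ℤ, hexSign r * q ^ (r ^ 2 + 2 * r) * baileyKernel (q ^ 2) r n = cubicBeta q n := by
  have hp : q ^ 2 ≠ 0 := pow_ne_zero 2 h0
  have hr := qPochInv_self_sub_one hp (norm_sq_lt_one hq)
  have n1 : 1 - q ^ (4 * n + 2) ≠ 0 := one_sub_pow_ne_zero hq (by omega)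
  have hz : ∀ {r : ℤ}, r < -n ∨ (n : ℤ) < r → thetaKernel q r n = 0 := thetaKernel_eq_zero h0
  have s0 : Summable fun r : ℤ => hexSign r * thetaKernel q r n :=
    summable_int_of_support (-n) n fun k hk => by rw [hz hk, mul_zero]
  have s2 : Summable fun r : ℤ => hexSign r * thetaKernel q (r + 1) n :=
    summable_int_of_support (-n - 1) (n - 1) fun k hk => by rw [hz (by omega), mul_zero]
  have t2 : ∑' r : ℤ, hexSign r * thetaKernel q (r + 1) n =
      ∑' r : ℤ, hexSign (r - 1) * thetaKernel q r n := by
    rw [← tsum_int_shift (fun r : ℤ => hexSign (r - 1) * thetaKernel q r n) 1]; simp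
  have t3 : ∑' r : ℤ, hexSign (r - 1) * thetaKernel q r n = 0 := by
    have h := (Equiv.neg ℤ).tsum_eq fun r : ℤ => hexSign (r - 1) * thetaKernel q r n
    simp only [Equiv.neg_apply, hexSign_neg_sub_one, thetaKernel_neg, neg_mul, tsum_neg] at h
    exact self_eq_neg.mp h.symm
  refine mul_left_cancel₀ n1 ?_
  have h : ∀ r : ℤ, (1 - q ^ (4 * n + 2)) *
      (hexSign r * q ^ (r ^ 2 + 2 * r) * baileyKernel (q ^ 2) r n) =
      (q ^ 2) ^ n * (hexSign r * thetaKernel q r n) +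
        q⁻¹ * (hexSign r * thetaKernel q (r + 1) n) := fun r => by
    unfold baileyKernel thetaKernel
    have e1 : qPochInv (q ^ 2) (q ^ 2) ((n : ℤ) + r) = (1 - (q ^ 2) ^ ((n : ℤ) + r + 1)) *
        qPochInv (q ^ 2) (q ^ 2) ((n : ℤ) + r + 1) := by
      rw [← hr, add_sub_cancel_right]
    have e2 : (n : ℤ) - (r + 1) = n - r - 1 := by ring
    have e3 : (n : ℤ) + (r + 1) = n + r + 1 := by ring
    have f1 : (q ^ 2) ^ ((n : ℤ) - r) * q ^ (r ^ 2 + 2 * r) = (q ^ 2) ^ n * q ^ (r ^ 2) := by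
      rw [← zpow_natCast (q ^ 2) n, sq_zpow, sq_zpow, ← zpow_add₀ h0, ← zpow_add₀ h0]
      congr 1; ring
    have f2 : q⁻¹ * q ^ ((r + 1) ^ 2) = q ^ (r ^ 2 + 2 * r) := by
      rw [← zpow_neg_one, ← zpow_add₀ h0]; congr 1; ring
    have f3 : q ^ (4 * n + 2) = (q ^ 2) ^ ((n : ℤ) - r) * (q ^ 2) ^ ((n : ℤ) + r + 1) := by
      rw [← zpow_add₀ hp, sq_zpow, ← zpow_natCast]; congr 1; push_cast; ring
    rw [e2, e3, hr, e1, f3]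
    linear_combination (hexSign r * qPochInv (q ^ 2) (q ^ 2) (n - r) *
      qPochInv (q ^ 2) (q ^ 2) (n + r + 1)) *
      ((1 - (q ^ 2) ^ ((n : ℤ) + r + 1)) * f1 - (1 - (q ^ 2) ^ ((n : ℤ) - r)) * f2)
  rw [← tsum_mul_left, tsum_congr h, (s0.mul_left _).tsum_add (s2.mul_left _), tsum_mul_left,
    tsum_mul_left, t2, t3, tsum_hexSign_mul_thetaKernel h0 hq, cubicBeta, qPoch_succ,
    show q ^ 2 * (q ^ 2) ^ (2 * n) = q ^ (4 * n + 2) by ring]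
  field_simp
  ring

/-! ### Iterating the Bailey chain -/

theorem summable_mul_baileyKernel {p : ℂ} (h0 : p ≠ 0) (α : ℤ → ℂ) (N : ℤ) :
    Summable fun r : ℤ => α r * baileyKernel p r N :=
  summable_int_of_support (-N - 1) N fun k hk => by rw [baileyKernel_eq_zero h0 hk, mul_zero]

/-- One step of the (limiting) Bailey chain relative to `a = p`. -/
theorem sum_antidiagonal_baileyPair {p : ℂ} (h0 : p ≠ 0) (hp : ‖p‖ < 1) (α : ℤ → ℂ) (N : ℕ) :
    ∑ x ∈ Finset.HasAntidiagonal.antidiagonal N,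
        qPochInv p p x.1 * (p ^ (x.2 ^ 2 + x.2) * ∑' r : ℤ, α r * baileyKernel p r x.2) =
      ∑' r : ℤ, α r * p ^ (r ^ 2 + r) * baileyKernel p r N := by
  have h : ∀ r : ℤ, α r * p ^ (r ^ 2 + r) * baileyKernel p r N =
      ∑ x ∈ Finset.HasAntidiagonal.antidiagonal N,
        qPochInv p p x.1 * p ^ (x.2 ^ 2 + x.2) * (α r * baileyKernel p r x.2) := fun r => by
    rw [mul_assoc, ← sum_antidiagonal_baileyKernel h0 hp, Finset.mul_sum]
    refine Finset.sum_congr rfl fun x _ => ?_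
    ring
  have hs : ∀ x ∈ Finset.HasAntidiagonal.antidiagonal N, Summable fun r : ℤ =>
      qPochInv p p x.1 * p ^ (x.2 ^ 2 + x.2) * (α r * baileyKernel p r x.2) := fun x _ =>
    (summable_mul_baileyKernel h0 α x.2).mul_left _
  rw [tsum_congr h, Summable.tsum_finsetSum hs]
  refine Finset.sum_congr rfl fun x _ => ?_
  rw [tsum_mul_left, mul_assoc]

/-- The general term of the multiple series produced by iterating the Bailey chain. -/
noncomputable def chainTerm (p : ℂ) (β : ℕ → ℂ) (w : ℕ) (n : Fin (w + 1) → ℕ) : ℂ :=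
  p ^ (∑ i, tailSum n i * (tailSum n i + 1)) *
    ((∏ i : Fin w, qPochInv p p (n i.castSucc)) * β (n (Fin.last w)))

theorem tailSum_zero {v : ℕ} (n : Fin (v + 1) → ℕ) : tailSum n 0 = ∑ i, n i := by
  have : Finset.Ici (0 : Fin (v + 1)) = Finset.univ := by ext i; simp
  simp [tailSum, this]

theorem tailSum_cons_succ {v : ℕ} (a : ℕ) (n : Fin v → ℕ) (i : Fin v) :
    tailSum (Fin.cons a n : Fin (v + 1) → ℕ) i.succ = tailSum n i := by
  have : Finset.Ici i.succ = (Finset.Ici i).map (Fin.succEmb v) := by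
    ext j
    refine Fin.cases ?_ (fun j => ?_) j
    · simp [Fin.succ_ne_zero]
    · simp
  rw [tailSum, this, Finset.sum_map]
  rfl

/-- A prepended index enters only the first tail sum, so it contributes exactly one step of the
chain. -/
theorem chainTerm_cons (p : ℂ) (β : ℕ → ℂ) (w a : ℕ) (n : Fin (w + 1) → ℕ) :
    chainTerm p β (w + 1) (Fin.cons a n) =
      p ^ ((a + ∑ i, n i) ^ 2 + (a + ∑ i, n i)) * (qPochInv p p a * chainTerm p β w n) := by
  unfold chainTerm
  rw [Fin.sum_univ_succ, Fin.prod_univ_succ, tailSum_zero, Fin.sum_univ_succ]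
  have hl : (Fin.cons a n : Fin (w + 2) → ℕ) (Fin.last (w + 1)) = n (Fin.last w) := rfl
  have hc : ∏ i : Fin w, qPochInv p p ((Fin.cons a n : Fin (w + 2) → ℕ) i.succ.castSucc) =
      ∏ i : Fin w, qPochInv p p (n i.castSucc) := rfl
  rw [hl, hc, Fin.castSucc_zero]
  simp only [tailSum_cons_succ, Fin.cons_zero, Fin.cons_succ]
  rw [pow_add, mul_add_one, ← sq]
  ring

theorem sum_antidiagonalTuple_succ {k : ℕ} (f : (Fin (k + 1) → ℕ) → ℂ) (M : ℕ) :
    ∑ n ∈ Finset.Nat.antidiagonalTuple (k + 1) M, f n =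
      ∑ x ∈ Finset.HasAntidiagonal.antidiagonal M,
        ∑ n ∈ Finset.Nat.antidiagonalTuple k x.2, f (Fin.cons x.1 n) := by
  rw [Finset.sum_sigma']
  refine Finset.sum_bij' (fun n _ => ⟨(n 0, ∑ i : Fin k, n i.succ), Fin.tail n⟩)
    (fun y _ => Fin.cons y.1.1 y.2) ?_ ?_ ?_ ?_ ?_
  · intro n hn
    rw [Finset.Nat.mem_antidiagonalTuple, Fin.sum_univ_succ] at hn
    simp [Finset.Nat.mem_antidiagonalTuple, hn, Fin.tail]
  · rintro ⟨⟨a, b⟩, n⟩ h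
    simp only [Finset.mem_sigma, Finset.HasAntidiagonal.mem_antidiagonal, Finset.Nat.mem_antidiagonalTuple] at h
    simp [Finset.Nat.mem_antidiagonalTuple, Fin.sum_univ_succ, h]
  · intro n _
    simp
  · rintro ⟨⟨a, b⟩, n⟩ h
    simp only [Finset.mem_sigma, Finset.HasAntidiagonal.mem_antidiagonal, Finset.Nat.mem_antidiagonalTuple] at h
    simp [h]
  · intro n _
    simp

/-- Iterating the Bailey chain: the part of the multiple series with `N_1 = M`. -/
theorem sum_chainTerm {p : ℂ} (h0 : p ≠ 0) (hp : ‖p‖ < 1) {α : ℤ → ℂ} {β : ℕ → ℂ}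
    (hβ : ∀ n : ℕ, β n = ∑' r : ℤ, α r * baileyKernel p r n) (w M : ℕ) :
    ∑ n ∈ Finset.Nat.antidiagonalTuple (w + 1) M, chainTerm p β w n =
      p ^ (M ^ 2 + M) * ∑' r : ℤ, α r * p ^ (w * (r ^ 2 + r)) * baileyKernel p r M := by
  induction w generalizing M with
  | zero =>
    have : tailSum ![M] 0 = M := by simp [tailSum_zero]
    simp [chainTerm, hβ, this, mul_add, sq]
  | succ w ih =>
    have h := sum_antidiagonal_baileyPair h0 hp (fun r => α r * p ^ (w * (r ^ 2 + r))) M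
    simp only [mul_assoc (α _), ← zpow_add₀ h0] at h
    have e : ∀ r : ℤ, (w : ℤ) * (r ^ 2 + r) + (r ^ 2 + r) = ((w + 1 : ℕ) : ℤ) * (r ^ 2 + r) :=
      fun r => by push_cast; ring
    simp only [e] at h
    simp only [mul_assoc (α _)] at ih ⊢
    rw [sum_antidiagonalTuple_succ, ← h, Finset.mul_sum]
    refine Finset.sum_congr rfl fun x hx => ?_
    rw [← ih, Finset.mul_sum, Finset.mul_sum]
    refine Finset.sum_congr rfl fun n hn => ?_
    rw [chainTerm_cons, Finset.Nat.mem_antidiagonalTuple.mp hn, Finset.HasAntidiagonal.mem_antidiagonal.mp hx]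

theorem summable_prod_pow {x : ℝ} (h0 : 0 ≤ x) (h1 : x < 1) (v : ℕ) :
    Summable fun n : Fin v → ℕ => ∏ i, x ^ n i := by
  induction v with
  | zero => exact (hasSum_fintype _).summable
  | succ v ih =>
    rw [← (Fin.consEquiv fun _ => ℕ).summable_iff]
    have := (summable_geometric_of_lt_one h0 h1).mul_of_nonneg ih (fun _ => by positivity)
      fun _ => Finset.prod_nonneg fun _ _ => by positivity
    refine this.congr fun y => ?_
    simp [Fin.prod_univ_succ, Fin.consEquiv]

theorem norm_baileyKernel_le {p : ℂ} {C : ℝ} (hC : ∀ j : ℤ, ‖qPochInv p p j‖ ≤ C) (r n : ℤ) :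
    ‖baileyKernel p r n‖ ≤ C * C := by
  rw [baileyKernel, norm_mul]
  exact mul_le_mul (hC _) (hC _) (norm_nonneg _) ((norm_nonneg _).trans (hC 0))

theorem summable_chainTerm {p : ℂ} (h0 : p ≠ 0) (hp : ‖p‖ < 1) {β : ℕ → ℂ} {D : ℝ}
    (hD : ∀ n, ‖β n‖ ≤ D) (w : ℕ) : Summable (chainTerm p β w) := by
  obtain ⟨C, -, hC⟩ := exists_norm_qPochInv_self_le h0 hp
  refine Summable.of_norm_bounded ((summable_prod_pow (norm_nonneg p) hp (w + 1)).mul_right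
    (C ^ w * D)) fun n => ?_
  rw [chainTerm, norm_mul, norm_mul, norm_pow, norm_prod]
  -- Keeping only `N_1 ≤ N_1 (N_1 + 1)` in the exponent already gives a product of geometric series.
  have h1 : ‖p‖ ^ (∑ i, tailSum n i * (tailSum n i + 1)) ≤ ∏ i, ‖p‖ ^ n i := by
    rw [Finset.prod_pow_eq_pow_sum, ← tailSum_zero n]
    refine pow_le_pow_of_le_one (norm_nonneg _) hp.le ?_
    exact (Nat.le_mul_of_pos_right _ (Nat.succ_pos _)).trans
      (Finset.single_le_sum (f := fun i => tailSum n i * (tailSum n i + 1))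
        (fun _ _ => Nat.zero_le _) (Finset.mem_univ 0))
  have h2 : ∏ i : Fin w, ‖qPochInv p p (n i.castSucc)‖ ≤ C ^ w := by
    refine (Finset.prod_le_prod (fun _ _ => norm_nonneg _) fun i _ => hC _).trans ?_
    simp
  have hC0 : 0 ≤ C := (norm_nonneg _).trans (hC 0)
  gcongr
  exact hD _

theorem norm_zpow_le_one {p : ℂ} (hp : ‖p‖ ≤ 1) {j : ℤ} (hj : 0 ≤ j) : ‖p ^ j‖ ≤ 1 := by
  lift j to ℕ using hj
  rw [zpow_natCast, norm_pow]
  exact pow_le_one₀ (norm_nonneg _) hp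

theorem sq_add_self_nonneg (r : ℤ) : 0 ≤ r ^ 2 + r := by
  rcases lt_or_ge r 0 with h | h <;> nlinarith

/-- The multiple series attached to a Bailey pair relative to `a = p`. -/
theorem hasSum_chainTerm {p : ℂ} (h0 : p ≠ 0) (hp : ‖p‖ < 1) {α : ℤ → ℂ} (hα : Summable α)
    {β : ℕ → ℂ} (hβ : ∀ n : ℕ, β n = ∑' r : ℤ, α r * baileyKernel p r n) (w : ℕ) :
    HasSum (chainTerm p β w)
      ((∑' r : ℤ, α r * p ^ (((w + 1 : ℕ) : ℤ) * (r ^ 2 + r))) / qPochInf p p) := by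
  obtain ⟨C, -, hC⟩ := exists_norm_qPochInv_self_le h0 hp
  have hC0 : 0 ≤ C := (norm_nonneg _).trans (hC 0)
  have hαn := hα.norm
  have hD : ∀ n, ‖β n‖ ≤ ∑' r : ℤ, ‖α r‖ * (C * C) := fun n => by
    rw [hβ]
    refine tsum_of_norm_bounded (hαn.mul_right (C * C)).hasSum fun r => ?_
    rw [norm_mul]
    exact mul_le_mul_of_nonneg_left (norm_baileyKernel_le hC _ _) (norm_nonneg _)
  have hsum := summable_chainTerm h0 hp hD w
  set e := Finset.Nat.sigmaAntidiagonalTupleEquivTuple (w + 1)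
  have hsig : Summable fun y => chainTerm p β w (e y) := e.summable_iff.mpr hsum
  set H : ℕ → ℂ := fun M => ∑ n ∈ Finset.Nat.antidiagonalTuple (w + 1) M, chainTerm p β w n
  have hfib : ∀ M, ∑' y : Finset.Nat.antidiagonalTuple (w + 1) M, chainTerm p β w (e ⟨M, y⟩) =
      H M := fun M => by
    rw [tsum_fintype]
    exact Finset.sum_coe_sort _ (chainTerm p β w)
  have hH : Summable H := by
    have := hsig.sigma
    simpa only [hfib] using this
  have hHn : Summable fun M => ‖H M‖ := hH.norm
  have hval : ∑' n, chainTerm p β w n = ∑' M, H M := by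
    rw [← e.tsum_eq, hsig.tsum_sigma]
    exact tsum_congr hfib
  have hne := qPochInf_ne_zero hp (one_sub_self_mul_pow_ne_zero hp)
  have hlim := tendsto_qPochInv_add hp (one_sub_self_mul_pow_ne_zero hp)
  -- `H M` collects the terms with `N_1 = M`. One further Bailey step gives `∑ H b / (p)_{N-b}`; as
  -- `N → ∞` this side yields one factor `1/(p)_∞` and the kernel side yields two, so one survives.
  have hL : Tendsto (fun N : ℕ => ∑' b : ℕ, qPochInv p p ((N : ℤ) + -b) * H b) atTop
      (𝓝 (∑' b : ℕ, (qPochInf p p)⁻¹ * H b)) := by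
    refine tendsto_tsum_of_dominated_convergence (hHn.mul_left C)
      (fun b => (hlim _).mul_const _) (Eventually.of_forall fun N b => ?_)
    rw [norm_mul]
    exact mul_le_mul_of_nonneg_right (hC _) (norm_nonneg _)
  have hR : Tendsto (fun N : ℕ => ∑' r : ℤ, α r * p ^ (((w + 1 : ℕ) : ℤ) * (r ^ 2 + r)) *
      baileyKernel p r N) atTop (𝓝 (∑' r : ℤ, α r * p ^ (((w + 1 : ℕ) : ℤ) * (r ^ 2 + r)) *
        ((qPochInf p p)⁻¹ * (qPochInf p p)⁻¹))) := by
    refine tendsto_tsum_of_dominated_convergence (hαn.mul_right (C * C))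
      (fun r => ?_) (Eventually.of_forall fun N r => ?_)
    · refine Tendsto.const_mul _ (((hlim (-r)).congr fun N => ?_).mul
        ((hlim (r + 1)).congr fun N => ?_))
      · rw [← sub_eq_add_neg]
      · rw [add_assoc]
    · rw [norm_mul, norm_mul]
      refine mul_le_mul ?_ (norm_baileyKernel_le hC _ _) (norm_nonneg _) (norm_nonneg _)
      exact mul_le_of_le_one_right (norm_nonneg _) (norm_zpow_le_one hp.le
        (mul_nonneg (Int.natCast_nonneg _) (sq_add_self_nonneg r)))
  have hLR : ∀ N : ℕ, ∑' b : ℕ, qPochInv p p ((N : ℤ) + -b) * H b =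
      ∑' r : ℤ, α r * p ^ (((w + 1 : ℕ) : ℤ) * (r ^ 2 + r)) * baileyKernel p r N := fun N => by
    have h := sum_antidiagonal_baileyPair h0 hp (fun r => α r * p ^ (w * (r ^ 2 + r))) N
    simp only [mul_assoc (α _), ← zpow_add₀ h0] at h
    have e : ∀ r : ℤ, (w : ℤ) * (r ^ 2 + r) + (r ^ 2 + r) = ((w + 1 : ℕ) : ℤ) * (r ^ 2 + r) :=
      fun r => by push_cast; ring
    simp only [e] at h
    have ih := sum_chainTerm h0 hp hβ w
    simp only [mul_assoc (α _)] at ih ⊢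
    rw [← h, tsum_eq_sum (s := Finset.range (N + 1)), ← Finset.Nat.sum_antidiagonal_swap,
      Finset.Nat.sum_antidiagonal_eq_sum_range_succ_mk]
    · refine Finset.sum_congr rfl fun i hi => ?_
      have hi := Finset.mem_range.mp hi
      have e1 : ((N - i : ℕ) : ℤ) = N + -i := by omega
      simp only [Prod.fst_swap, Prod.snd_swap, e1, H, ih]
    · intro b hb
      rw [Finset.mem_range] at hb
      rw [qPochInv_self_of_neg h0 (by omega), zero_mul]
  have hfin := tendsto_nhds_unique (hL.congr hLR) hR
  rw [tsum_mul_left, tsum_mul_right] at hfin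
  have := hsum.hasSum
  rw [hval] at this
  convert this using 1
  rw [div_eq_mul_inv]
  refine mul_left_cancel₀ (inv_ne_zero hne) ?_
  rw [hfin]
  ring

/-! ### The quintuple product identity -/

/-- The summand of the finite quintuple product identity. -/
noncomputable def quintTerm (s : ℤ → ℂ) (b x : ℂ) (m n k : ℤ) : ℂ :=
  s k * (1 + x * b ^ k) * (qPochInv b b (m + k) * qPochInv b b (n - k) *
    qPochInv (b / x ^ 2) b (m - k) * qPochInv (x ^ 2) b (n + k + 1))

/-- The telescoping certificate for `quintTerm`. -/
noncomputable def quintCert (s : ℤ → ℂ) (b x : ℂ) (m n k : ℤ) : ℂ :=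
  b ^ (-k) * (s k * (qPochInv b b (m + k - 1) * qPochInv b b (n - k) *
    qPochInv (b / x ^ 2) b (m - k) * qPochInv (x ^ 2) b (n + k)))

theorem quintTerm_eq_zero {s : ℤ → ℂ} {b x : ℂ} (hb0 : b ≠ 0) {m n k : ℤ} (h : k < -m ∨ n < k) :
    quintTerm s b x m n k = 0 := by
  unfold quintTerm
  rcases h with h | h
  · rw [qPochInv_self_of_neg hb0 (by omega : m + k < 0)]; ring
  · rw [qPochInv_self_of_neg hb0 (by omega : n - k < 0)]; ring

theorem quintCert_eq_zero {s : ℤ → ℂ} {b x : ℂ} (hb0 : b ≠ 0) {m n k : ℤ} (h : k < -m ∨ n < k) :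
    quintCert s b x m n k = 0 := by
  unfold quintCert
  rcases h with h | h
  · rw [qPochInv_self_of_neg hb0 (by omega : m + k - 1 < 0)]; ring
  · rw [qPochInv_self_of_neg hb0 (by omega : n - k < 0)]; ring

theorem summable_quintTerm {s : ℤ → ℂ} {b x : ℂ} (hb0 : b ≠ 0) (m n : ℤ) :
    Summable (quintTerm s b x m n) :=
  summable_int_of_support (-m) n fun _ hk => quintTerm_eq_zero hb0 hk

theorem tsum_quintCert_sub {s : ℤ → ℂ} {b x : ℂ} (hb0 : b ≠ 0) (m n : ℤ) :
    ∑' k : ℤ, (quintCert s b x m n (k + 1) - quintCert s b x m n k) = 0 := by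
  have h : Summable (quintCert s b x m n) :=
    summable_int_of_support (-m) n fun _ hk => quintCert_eq_zero hb0 hk
  have h1 : Summable fun k : ℤ => quintCert s b x m n (k + 1) :=
    (Equiv.addRight (1 : ℤ)).summable_iff.mpr h
  rw [h1.tsum_sub h, tsum_int_shift, sub_self]

theorem one_sub_sq_mul_pow_ne_zero {b x : ℂ} (hx : ∀ j : ℤ, 1 - x ^ 2 * b ^ j ≠ 0) (n : ℕ) :
    1 - x ^ 2 * b ^ n ≠ 0 := by
  simpa using hx n

theorem one_sub_div_sq_mul_pow_ne_zero {b x : ℂ} (hx0 : x ≠ 0) (hb0 : b ≠ 0)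
    (hx : ∀ j : ℤ, 1 - x ^ 2 * b ^ j ≠ 0) (n : ℕ) : 1 - b / x ^ 2 * b ^ n ≠ 0 := by
  intro h
  apply hx (-(n + 1 : ℕ))
  rw [zpow_neg, zpow_natCast, pow_succ b]
  have : x ^ 2 = b ^ n * b := by
    have h2 : b / x ^ 2 * b ^ n = 1 := (sub_eq_zero.mp h).symm
    field_simp at h2
    linear_combination -h2
  rw [this, mul_inv_cancel₀ (mul_ne_zero (pow_ne_zero _ hb0) hb0), sub_self]

/-- Creative telescoping in `n`: after the common reciprocals are factored out, this is a rational
identity in `x`, `b`, `b^k`, `b^m` and `b^(n+1)`. Keeping `m` and `n` independent lets the same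
certificate serve the recurrence in `m`. -/
theorem quintTerm_succ_right {s : ℤ → ℂ} {b x : ℂ} (hb0 : b ≠ 0) (hb : ‖b‖ < 1) (hx0 : x ≠ 0)
    (hx : ∀ j : ℤ, 1 - x ^ 2 * b ^ j ≠ 0)
    (hs : ∀ k, s (k + 1) = -x ^ 3 * b ^ (3 * k + 1) * s k) (m n k : ℤ) :
    (1 - b ^ (m + n + 1)) * (1 - x * b ^ (n + 1)) * quintTerm s b x m (n + 1) k -
      quintTerm s b x m n k =
    -b ^ (n + 1) * (quintCert s b x m (n + 1) (k + 1) - quintCert s b x m (n + 1) k) := by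
  have hr := qPochInv_self_sub_one hb0 hb
  have hv := qPochInv_sub_one (one_sub_sq_mul_pow_ne_zero hx)
  have hw := qPochInv_sub_one (one_sub_div_sq_mul_pow_ne_zero hx0 hb0 hx)
  have hy : b ^ k ≠ 0 := zpow_ne_zero k hb0
  have z1 : b ^ (3 * k + 1) = (b ^ k) ^ 3 * b := by
    rw [zpow_add_one₀ hb0, mul_comm 3 k, zpow_mul]; norm_cast
  have z2 : b ^ (-(k + 1)) = (b ^ k * b)⁻¹ := by rw [zpow_neg, zpow_add_one₀ hb0]
  have z3 : b ^ (-k) = (b ^ k)⁻¹ := zpow_neg _ _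
  have v1 : qPochInv b b (n - k) = (1 - b ^ (n + 1) / b ^ k) * qPochInv b b (n + 1 - k) := by
    rw [← zpow_sub₀ hb0, ← hr]; congr 1; ring
  have v2 : qPochInv (x ^ 2) b (n + k + 1) =
      (1 - x ^ 2 * (b ^ (n + 1) * b ^ k)) * qPochInv (x ^ 2) b (n + 1 + k + 1) := by
    rw [← zpow_add₀ hb0, show n + k + 1 = n + 1 + k + 1 - 1 by ring, hv, add_sub_cancel_right]
  have v3 : qPochInv b b (n + 1 - (k + 1)) =
      (1 - b ^ (n + 1) / b ^ k) * qPochInv b b (n + 1 - k) := by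
    rw [← v1]; congr 1; ring
  have v4 : qPochInv (b / x ^ 2) b (m - (k + 1)) =
      (1 - b ^ m / (x ^ 2 * b ^ k)) * qPochInv (b / x ^ 2) b (m - k) := by
    rw [show m - (k + 1) = m - k - 1 by ring, hw, zpow_sub_one₀ hb0, zpow_sub₀ hb0]
    field_simp
  have v5 : qPochInv b b (m + (k + 1) - 1) = qPochInv b b (m + k) := by congr 1; ring
  have v6 : qPochInv (x ^ 2) b (n + 1 + (k + 1)) = qPochInv (x ^ 2) b (n + 1 + k + 1) := by
    congr 1; ring
  have v7 : qPochInv b b (m + k - 1) = (1 - b ^ m * b ^ k) * qPochInv b b (m + k) := by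
    rw [hr, zpow_add₀ hb0]
  have v8 : qPochInv (x ^ 2) b (n + 1 + k) =
      (1 - x ^ 2 * (b ^ (n + 1) * b ^ k)) * qPochInv (x ^ 2) b (n + 1 + k + 1) := by
    rw [← v2]; congr 1; ring
  have z4 : b ^ (m + n + 1) = b ^ m * b ^ (n + 1) := by rw [← zpow_add₀ hb0, add_assoc]
  unfold quintTerm quintCert
  rw [hs, v1, v2, v3, v4, v5, v6, v7, v8, z1, z2, z3, z4]
  generalize b ^ k = y at *
  generalize b ^ (n + 1) = N, b ^ m = M, qPochInv b b (m + k) = c₁,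
    qPochInv b b (n + 1 - k) = c₂, qPochInv (b / x ^ 2) b (m - k) = c₃,
    qPochInv (x ^ 2) b (n + 1 + k + 1) = c₄
  field_simp
  ring

theorem quintTerm_succ_left {s : ℤ → ℂ} {b x : ℂ} (hb0 : b ≠ 0) (hb : ‖b‖ < 1) (hx0 : x ≠ 0)
    (hx : ∀ j : ℤ, 1 - x ^ 2 * b ^ j ≠ 0)
    (hs : ∀ k, s (k + 1) = -x ^ 3 * b ^ (3 * k + 1) * s k) (m n k : ℤ) :
    (1 - b ^ (m + n + 1)) * (1 - b ^ (m + 1) / x) * quintTerm s b x (m + 1) n k -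
      quintTerm s b x m n k =
    -(b ^ (m + 1) / x ^ 2) *
      (quintCert s b x (m + 1) n (k + 1) - quintCert s b x (m + 1) n k) := by
  have hr := qPochInv_self_sub_one hb0 hb
  have hv := qPochInv_sub_one (one_sub_sq_mul_pow_ne_zero hx)
  have hw := qPochInv_sub_one (one_sub_div_sq_mul_pow_ne_zero hx0 hb0 hx)
  have hy : b ^ k ≠ 0 := zpow_ne_zero k hb0
  have z1 : b ^ (3 * k + 1) = (b ^ k) ^ 3 * b := by
    rw [zpow_add_one₀ hb0, mul_comm 3 k, zpow_mul]; norm_cast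
  have z2 : b ^ (-(k + 1)) = (b ^ k * b)⁻¹ := by rw [zpow_neg, zpow_add_one₀ hb0]
  have z3 : b ^ (-k) = (b ^ k)⁻¹ := zpow_neg _ _
  have v1 : qPochInv b b (m + k) = (1 - b ^ (m + 1) * b ^ k) * qPochInv b b (m + 1 + k) := by
    rw [← zpow_add₀ hb0, ← hr]; congr 1; ring
  have v2 : qPochInv (b / x ^ 2) b (m - k) =
      (1 - b ^ (m + 1) / (x ^ 2 * b ^ k)) * qPochInv (b / x ^ 2) b (m + 1 - k) := by
    rw [show m - k = m + 1 - k - 1 by ring, hw, zpow_sub_one₀ hb0, zpow_sub₀ hb0]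
    field_simp
  have v3 : qPochInv b b (n - (k + 1)) = (1 - b ^ n / b ^ k) * qPochInv b b (n - k) := by
    rw [← zpow_sub₀ hb0, ← hr]; congr 1; ring
  have v4 : qPochInv (b / x ^ 2) b (m + 1 - (k + 1)) =
      (1 - b ^ (m + 1) / (x ^ 2 * b ^ k)) * qPochInv (b / x ^ 2) b (m + 1 - k) := by
    rw [← v2]; congr 1; ring
  have v5 : qPochInv b b (m + 1 + (k + 1) - 1) = qPochInv b b (m + 1 + k) := by congr 1; ring
  have v6 : qPochInv (x ^ 2) b (n + (k + 1)) = qPochInv (x ^ 2) b (n + k + 1) := by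
    congr 1; ring
  have v7 : qPochInv b b (m + 1 + k - 1) =
      (1 - b ^ (m + 1) * b ^ k) * qPochInv b b (m + 1 + k) := by
    rw [hr, zpow_add₀ hb0]
  have v8 : qPochInv (x ^ 2) b (n + k) =
      (1 - x ^ 2 * (b ^ n * b ^ k)) * qPochInv (x ^ 2) b (n + k + 1) := by
    rw [← zpow_add₀ hb0]
    simpa using hv (n + k + 1)
  have z4 : b ^ (m + n + 1) = b ^ (m + 1) * b ^ n := by rw [← zpow_add₀ hb0]; congr 1; ring
  unfold quintTerm quintCert
  rw [hs, v1, v2, v3, v4, v5, v6, v7, v8, z1, z2, z3, z4]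
  generalize b ^ k = y at *
  generalize b ^ (m + 1) = M, b ^ n = N, qPochInv b b (m + 1 + k) = c₁,
    qPochInv b b (n - k) = c₂, qPochInv (b / x ^ 2) b (m + 1 - k) = c₃,
    qPochInv (x ^ 2) b (n + k + 1) = c₄
  field_simp
  ring

/-- The finite form of the quintuple product identity. -/
theorem tsum_quintTerm {s : ℤ → ℂ} {b x : ℂ} (hb0 : b ≠ 0) (hb : ‖b‖ < 1) (hx0 : x ≠ 0)
    (hx : ∀ j : ℤ, 1 - x ^ 2 * b ^ j ≠ 0)
    (hs : ∀ k, s (k + 1) = -x ^ 3 * b ^ (3 * k + 1) * s k)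
    (hs0 : s 0 = 1) (n : ℕ) :
    ∑' k : ℤ, quintTerm s b x n n k =
      (qPoch b b (2 * n))⁻¹ * (qPoch (b / x) b n)⁻¹ * (qPoch x b (n + 1))⁻¹ := by
  -- If `x b^j = 1`, squaring gives `x² b^(2j) = 1`, which `hx` excludes.
  have hxn : ∀ j : ℤ, 1 - x * b ^ j ≠ 0 := fun j h => hx (j + j) (by
    rw [zpow_add₀ hb0]; linear_combination (1 + x * b ^ j) * h)
  have hR : ∀ m n : ℤ, (1 - b ^ (m + n + 1)) * (1 - x * b ^ (n + 1)) *
      ∑' k : ℤ, quintTerm s b x m (n + 1) k = ∑' k : ℤ, quintTerm s b x m n k := fun m n => by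
    have h := tsum_congr (L := .unconditional ℤ) (quintTerm_succ_right hb0 hb hx0 hx hs m n)
    rw [((summable_quintTerm hb0 m (n + 1)).mul_left _).tsum_sub (summable_quintTerm hb0 m n),
      tsum_mul_left, tsum_mul_left, tsum_quintCert_sub hb0, mul_zero] at h
    exact sub_eq_zero.mp h
  have hL : ∀ m n : ℤ, (1 - b ^ (m + n + 1)) * (1 - b ^ (m + 1) / x) *
      ∑' k : ℤ, quintTerm s b x (m + 1) n k = ∑' k : ℤ, quintTerm s b x m n k := fun m n => by
    have h := tsum_congr (L := .unconditional ℤ) (quintTerm_succ_left hb0 hb hx0 hx hs m n)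
    rw [((summable_quintTerm hb0 (m + 1) n).mul_left _).tsum_sub (summable_quintTerm hb0 m n),
      tsum_mul_left, tsum_mul_left, tsum_quintCert_sub hb0, mul_zero] at h
    exact sub_eq_zero.mp h
  induction n with
  | zero =>
    rw [tsum_eq_single 0 fun k hk => quintTerm_eq_zero hb0 (by push_cast; omega)]
    have h1 : 1 - x ^ 2 ≠ 0 := by simpa using hx 0
    have h2 : 1 - x ≠ 0 := by simpa using hxn 0
    have h3 : qPochInv (x ^ 2) b 1 = (1 - x ^ 2)⁻¹ := by
      simpa [qPoch] using qPochInv_natCast (x ^ 2) b 1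
    simp [quintTerm, hs0, h3, qPoch]
    field_simp
    ring
  | succ n ih =>
    have h1 := hR n n
    rw [← hL, ih] at h1
    have n1 : 1 - b ^ (2 * n + 1) ≠ 0 := one_sub_pow_ne_zero hb (by omega)
    have n2 : 1 - b ^ (2 * n + 2) ≠ 0 := one_sub_pow_ne_zero hb (by omega)
    have n3 : 1 - x * b ^ (n + 1) ≠ 0 := by
      rw [← zpow_natCast]; exact hxn _
    have n4 : 1 - b / x * b ^ n ≠ 0 := by
      intro h
      apply hxn (-(n + 1 : ℕ))
      rw [zpow_neg, zpow_natCast]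
      field_simp at h ⊢
      rw [pow_succ]
      linear_combination -h
    have e1 : b ^ ((n : ℤ) + n + 1) = b ^ (2 * n + 1) := by
      rw [← zpow_natCast]; congr 1; push_cast; ring
    have e2 : b ^ ((n : ℤ) + (n + 1) + 1) = b ^ (2 * n + 2) := by
      rw [← zpow_natCast]; congr 1; push_cast; ring
    have e3 : b ^ ((n : ℤ) + 1) = b ^ (n + 1) := by norm_cast
    rw [e1, e2, e3] at h1
    push_cast
    rw [show 2 * (n + 1) = 2 * n + 1 + 1 by ring]
    simp only [qPoch_succ]
    have g1 : b * b ^ (2 * n) = b ^ (2 * n + 1) := by ring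
    have g2 : b * b ^ (2 * n + 1) = b ^ (2 * n + 2) := by ring
    have g3 : b ^ (n + 1) / x = b / x * b ^ n := by ring
    rw [g3] at h1
    rw [g1, g2]
    simp only [qPoch_succ] at h1
    refine mul_left_cancel₀ (mul_ne_zero (mul_ne_zero n1 n3) (mul_ne_zero n2 n4)) ?_
    have h2 : (1 - b ^ (2 * n + 1)) * (1 - x * b ^ (n + 1)) * ((1 - b ^ (2 * n + 2)) *
        (1 - b / x * b ^ n)) * ∑' k : ℤ, quintTerm s b x (↑n + 1) (↑n + 1) k =
        (qPoch b b (2 * n))⁻¹ * (qPoch (b / x) b n)⁻¹ * (qPoch x b n * (1 - x * b ^ n))⁻¹ := by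
      rw [← h1]; ring
    have n5 : x - b * b ^ n ≠ 0 := by
      have : x - b * b ^ n = x * (1 - b / x * b ^ n) := by field_simp
      rw [this]; exact mul_ne_zero hx0 n4
    rw [h2]
    field_simp

/-- The quintuple product identity; `s k` stands for `(-1) ^ k x ^ (3k) b ^ (k (3k - 1) / 2)`,
described by its recurrence. -/
theorem tsum_eq_quintQ {s : ℤ → ℂ} {b x : ℂ} (hb0 : b ≠ 0) (hb : ‖b‖ < 1) (hx0 : x ≠ 0)
    (hx : ∀ j : ℤ, 1 - x ^ 2 * b ^ j ≠ 0)
    (hs : ∀ k, s (k + 1) = -x ^ 3 * b ^ (3 * k + 1) * s k) (hs0 : s 0 = 1)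
    (hsum : Summable fun k : ℤ => s k * (1 + x * b ^ k)) :
    ∑' k : ℤ, s k * (1 + x * b ^ k) = quintQ b x := by
  have hxn : ∀ j : ℤ, 1 - x * b ^ j ≠ 0 := fun j h => hx (j + j) (by
    rw [zpow_add₀ hb0]; linear_combination (1 + x * b ^ j) * h)
  have nz1 := one_sub_self_mul_pow_ne_zero hb
  have nz2 := one_sub_div_sq_mul_pow_ne_zero hx0 hb0 hx
  have nz3 := one_sub_sq_mul_pow_ne_zero hx
  obtain ⟨C₁, hC₁, h₁⟩ := exists_norm_qPochInv_self_le hb0 hb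
  obtain ⟨C₂, hC₂, h₂⟩ := exists_norm_qPochInv_le hb nz2
  obtain ⟨C₃, hC₃, h₃⟩ := exists_norm_qPochInv_le hb nz3
  have hL : Tendsto (fun n : ℕ => ∑' k : ℤ, quintTerm s b x n n k) atTop
      (𝓝 (∑' k : ℤ, s k * (1 + x * b ^ k) * ((qPochInf b b)⁻¹ * (qPochInf b b)⁻¹ *
        (qPochInf (b / x ^ 2) b)⁻¹ * (qPochInf (x ^ 2) b)⁻¹))) := by
    refine tendsto_tsum_of_dominated_convergence (hsum.norm.mul_right (C₁ * C₁ * C₂ * C₃))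
      (fun k => ?_) (Eventually.of_forall fun n k => ?_)
    · refine Tendsto.const_mul _ (((Tendsto.mul (tendsto_qPochInv_add hb nz1 k)
        ((tendsto_qPochInv_add hb nz1 (-k)).congr fun n => ?_)).mul
        ((tendsto_qPochInv_add hb nz2 (-k)).congr fun n => ?_)).mul
        ((tendsto_qPochInv_add hb nz3 (k + 1)).congr fun n => ?_))
      · rw [← sub_eq_add_neg]
      · rw [← sub_eq_add_neg]
      · rw [add_assoc]
    -- Reciprocals with base `b / x²` or `x²` are bounded only at nonnegative indices. For `-n ≤ k ≤
    -- n` the indices are nonnegative; elsewhere the term is zero.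
    · by_cases hk : k < -n ∨ (n : ℤ) < k
      · rw [quintTerm_eq_zero hb0 hk, norm_zero]
        positivity
      · have i₂ := h₂ (n - k) (by omega)
        have i₃ := h₃ (n + k + 1) (by omega)
        have i₁ := h₁ (n + k)
        have i₄ := h₁ (n - k)
        rw [quintTerm, norm_mul _ (_ * _)]
        refine mul_le_mul_of_nonneg_left ?_ (norm_nonneg _)
        rw [norm_mul, norm_mul, norm_mul]
        gcongr
  have hR : Tendsto (fun n : ℕ => (qPoch b b (2 * n))⁻¹ * (qPoch (b / x) b n)⁻¹ *
      (qPoch x b (n + 1))⁻¹) atTop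
      (𝓝 ((qPochInf b b)⁻¹ * (qPochInf (b / x) b)⁻¹ * (qPochInf x b)⁻¹)) := by
    have h2 : Tendsto (fun n : ℕ => 2 * n) atTop atTop :=
      tendsto_id.const_mul_atTop' (by norm_num)
    refine Tendsto.mul (Tendsto.mul ?_ ?_) ?_
    · exact ((tendsto_qPoch b b hb).comp h2).inv₀ (qPochInf_ne_zero hb nz1)
    · refine (tendsto_qPoch _ _ hb).inv₀ (qPochInf_ne_zero hb fun n h => ?_)
      apply hxn (-(n + 1 : ℕ))
      rw [zpow_neg, zpow_natCast]
      field_simp at h ⊢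
      rw [pow_succ]
      linear_combination -h
    · exact ((tendsto_qPoch x b hb).comp (tendsto_add_atTop_nat 1)).inv₀
        (qPochInf_ne_zero hb fun n => by simpa using hxn n)
  have h := tendsto_nhds_unique hL (hR.congr fun n =>
    (tsum_quintTerm hb0 hb hx0 hx hs hs0 n).symm)
  rw [tsum_mul_right] at h
  have m1 := qPochInf_ne_zero hb nz1
  have m2 := qPochInf_ne_zero hb nz2
  have m3 := qPochInf_ne_zero hb nz3
  -- Separating even and odd factors, then using `(a²; b²)_∞ = (a; b)_∞ (-a; b)_∞`, exposes the
  -- factors `(b/x; b)_∞` and `(x; b)_∞` that cancel against the right-hand side.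
  have e2 : qPochInf (b / x ^ 2) b = qPochInf (b / x ^ 2) (b ^ 2) *
      (qPochInf (b / x) b * qPochInf (-(b / x)) b) := by
    rw [← qPochInf_sq_sq hb, qPochInf_eq_mul_sq hb]
    congr 2
    field_simp
  have e3 : qPochInf (x ^ 2) b = qPochInf x b * qPochInf (-x) b *
      qPochInf (x ^ 2 * b) (b ^ 2) := by
    rw [← qPochInf_sq_sq hb, ← qPochInf_eq_mul_sq hb]
  rw [e2] at m2 h
  rw [e3] at m3 h
  simp only [ne_eq, mul_eq_zero, not_or] at m2 m3
  obtain ⟨k1, k2, k3⟩ := m2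
  obtain ⟨⟨k4, k5⟩, k6⟩ := m3
  rw [quintQ]
  field_simp at h
  rw [h]
  ring

/-! ### From the theta series to the theorem -/

theorem tsum_int_eq_tsum_three_mul {f : ℤ → ℂ} (hf : Summable f) :
    Summable (fun k : ℤ => f (3 * k) + f (3 * k + 1) + f (3 * k + 2)) ∧
      ∑' r : ℤ, f r = ∑' k : ℤ, (f (3 * k) + f (3 * k + 1) + f (3 * k + 2)) := by
  have hs : Summable fun y => f ((Int.divModEquiv 3).symm y) :=
    (Int.divModEquiv 3).symm.summable_iff.mpr hf
  have h : ∀ k : ℤ, ∑' i : Fin 3, f ((Int.divModEquiv 3).symm (k, i)) =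
      f (3 * k) + f (3 * k + 1) + f (3 * k + 2) := fun k => by
    rw [tsum_fintype, Fin.sum_univ_three]
    simp [Int.divModEquiv, mul_comm]
  constructor
  · simpa only [h] using hs.prod
  · rw [← (Int.divModEquiv 3).symm.tsum_eq, hs.tsum_prod]
    exact tsum_congr h

theorem summable_hexSign_mul_zpow {q : ℂ} (h0 : q ≠ 0) (hq : ‖q‖ < 1) :
    Summable fun r : ℤ => hexSign r * q ^ (r ^ 2 + 2 * r) := by
  have hn : 0 < ‖q‖ := norm_pos_iff.mpr h0
  have hg := summable_geometric_of_lt_one hn.le hq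
  have hs : Summable fun r : ℤ => ‖q‖ ^ r.natAbs :=
    Summable.of_nat_of_neg (by simpa using hg) (by simpa using hg)
  refine Summable.of_norm_bounded (hs.mul_left (‖q‖ ^ (-2 : ℤ))) fun r => ?_
  rw [norm_mul, norm_zpow]
  refine (mul_le_of_le_one_left (by positivity) (norm_hexSign_le r)).trans ?_
  rw [← zpow_natCast, ← zpow_add₀ hn.ne']
  refine zpow_le_zpow_right_of_le_one₀ hn hq.le ?_
  -- The bound is `r² + 2r ≥ |r| - 2`; for negative `r` it reads `(r + 1)(r + 2) ≥ 0`, with equality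
  -- at `-1` and `-2`.
  rcases lt_or_ge r 0 with h | h
  · rcases (show r = -1 ∨ r ≤ -2 by omega) with rfl | h'
    · norm_num
    · have : (r.natAbs : ℤ) = -r := by omega
      nlinarith
  · have : (r.natAbs : ℤ) = r := by omega
    nlinarith

theorem tsum_hexSign_eq_quintQ {q : ℂ} (h0 : q ≠ 0) (hq : ‖q‖ < 1) {v : ℕ} (hv : 1 ≤ v) :
    ∑' r : ℤ, hexSign r * q ^ (r ^ 2 + 2 * r) * (q ^ 2) ^ ((v : ℤ) * (r ^ 2 + r)) =
      quintQ (q ^ (12 * v + 6)) (q ^ (4 * v + 3)) := by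
  set f : ℤ → ℂ := fun r => hexSign r * q ^ (r ^ 2 + 2 * r) * (q ^ 2) ^ ((v : ℤ) * (r ^ 2 + r))
    with hf_def
  have hf : Summable f := by
    refine Summable.of_norm_bounded (summable_hexSign_mul_zpow h0 hq).norm fun r => ?_
    rw [norm_mul]
    exact mul_le_of_le_one_right (norm_nonneg _) (norm_zpow_le_one (norm_sq_lt_one hq).le
      (mul_nonneg (Int.natCast_nonneg _) (sq_add_self_nonneg r)))
  set s : ℤ → ℂ := fun k => (-1) ^ k * q ^ (9 * (2 * (v : ℤ) + 1) * k ^ 2 + (6 * v + 6) * k)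
    with hs_def
  have hpow : ∀ (n : ℕ) (j : ℤ), (q ^ n) ^ j = q ^ (n * j) := fun n j => by
    rw [zpow_mul, zpow_natCast]
  -- The exponent of `q` is `(2v+1) r² + (2v+2) r`. Passing from `r = 3k` to `3k + 1` adds `(4v+3) +
  -- (12v+6) k`, hence `x = q^(4v+3)` and `b = q^(12v+6)`.
  have hterm : ∀ k : ℤ, f (3 * k) + f (3 * k + 1) + f (3 * k + 2) =
      s k * (1 + q ^ (4 * v + 3) * (q ^ (12 * v + 6)) ^ k) := fun k => by
    simp only [hf_def, hs_def, hexSign_three_mul, hexSign_three_mul_add_one,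
      hexSign_three_mul_add_two, zero_mul, add_zero, mul_add, mul_one]
    congr 1
    · rw [sq_zpow, mul_assoc, ← zpow_add₀ h0]
      congr 2; ring
    · rw [sq_zpow, mul_assoc, ← zpow_add₀ h0, hpow, ← zpow_natCast, ← zpow_add₀ h0, mul_assoc,
        ← zpow_add₀ h0]
      congr 2; push_cast; ring
  obtain ⟨hsum, htsum⟩ := tsum_int_eq_tsum_three_mul hf
  simp only [hterm] at hsum htsum
  rw [htsum]
  refine tsum_eq_quintQ (pow_ne_zero _ h0) ?_ (pow_ne_zero _ h0) (fun j => ?_) (fun k => ?_) ?_ hsum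
  · rw [norm_pow]
    exact pow_lt_one₀ (norm_nonneg _) hq (by omega)
  · rw [← pow_mul, hpow, ← zpow_natCast, ← zpow_add₀ h0]
    -- The exponent of `x² b^j` is `8v + 6 + (12v+6) j`. At `j = -1` it equals `-4v`, so `v ≥ 1` is
    -- essential here.
    refine one_sub_zpow_ne_zero hq ?_
    push_cast
    rcases lt_or_ge j 0 with h | h
    · have : ((12 * v + 6 : ℤ)) * (j + 1) ≤ 0 :=
        mul_nonpos_of_nonneg_of_nonpos (by omega) (by omega)
      have : (1 : ℤ) ≤ v := by exact_mod_cast hv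
      nlinarith
    · positivity
  · simp only [hs_def]
    rw [hpow, ← pow_mul, zpow_add_one₀ (by norm_num : (-1 : ℂ) ≠ 0)]
    have e : q ^ (9 * (2 * (v : ℤ) + 1) * (k + 1) ^ 2 + (6 * v + 6) * (k + 1)) =
        q ^ ((4 * v + 3) * 3) * q ^ (((12 * v + 6 : ℕ) : ℤ) * (3 * k + 1)) *
          q ^ (9 * (2 * (v : ℤ) + 1) * k ^ 2 + (6 * v + 6) * k) := by
      rw [← zpow_natCast, ← zpow_add₀ h0, ← zpow_add₀ h0]
      congr 1; push_cast; ring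
    rw [e]
    ring
  · simp [hs_def]

theorem hasSum_chainTerm_cubicBeta {q : ℂ} (h0 : q ≠ 0) (hq : ‖q‖ < 1) (w : ℕ) :
    HasSum (chainTerm (q ^ 2) (cubicBeta q) w)
      (quintQ (q ^ (12 * (w + 1) + 6)) (q ^ (4 * (w + 1) + 3)) / qPochInf (q ^ 2) (q ^ 2)) := by
  rw [← tsum_hexSign_eq_quintQ h0 hq (by omega : 1 ≤ w + 1)]
  exact hasSum_chainTerm (pow_ne_zero 2 h0) (norm_sq_lt_one hq) (summable_hexSign_mul_zpow h0 hq)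
    (fun n => (tsum_hexSign_mul_baileyKernel h0 hq n).symm) w

theorem mainTheorem12 (q : ℂ) (hq0 : 0 < ‖q‖) (hq1 : ‖q‖ < 1) :
    (∀ (v : ℕ) (hv : 1 ≤ v),
      HasSum
        (fun n : Fin v → ℕ =>
          -- `nv` is the last of the summation indices `n_1, …, n_v`
          let nv : ℕ := n ⟨v - 1, Nat.sub_one_lt_of_le hv le_rfl⟩
          (q ^ 2) ^ ((∑ i : Fin v, tailSum n i * (tailSum n i + 1)) + nv) /
              ((∏ i : Fin (v - 1), qPoch (q ^ 2) (q ^ 2) (n (Fin.castLE (Nat.sub_le v 1) i))) *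
                qPoch (q ^ 2) (q ^ 2) (2 * nv + 1)) *
            (qPoch (q ^ 3) (q ^ 6) nv / qPoch q (q ^ 2) nv))
        (quintQ (q ^ (12 * v + 6)) (q ^ (4 * v + 3)) / qPochInf (q ^ 2) (q ^ 2))) ∧
    HasSum
      (fun n : ℕ =>
        (q ^ 2) ^ (n * (n + 2)) / qPoch (q ^ 2) (q ^ 2) (2 * n + 1) *
          (qPoch (q ^ 3) (q ^ 6) n / qPoch q (q ^ 2) n))
      (quintQ (q ^ 18) (q ^ 7) / qPochInf (q ^ 2) (q ^ 2)) := by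
  have h0 : q ≠ 0 := norm_pos_iff.mp hq0
  constructor
  · rintro v hv
    obtain ⟨w, rfl⟩ : ∃ w, v = w + 1 := ⟨v - 1, by omega⟩
    convert hasSum_chainTerm_cubicBeta h0 hq1 w using 2 with n
    change (q ^ 2) ^ ((∑ i, tailSum n i * (tailSum n i + 1)) + n (Fin.last w)) /
        ((∏ i : Fin w, qPoch (q ^ 2) (q ^ 2) (n i.castSucc)) *
          qPoch (q ^ 2) (q ^ 2) (2 * n (Fin.last w) + 1)) *
        (qPoch (q ^ 3) (q ^ 6) (n (Fin.last w)) / qPoch q (q ^ 2) (n (Fin.last w))) = _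
    rw [chainTerm, cubicBeta]
    simp only [qPochInv_natCast, Finset.prod_inv_distrib, pow_add]
    rw [div_eq_mul_inv, div_eq_mul_inv, mul_inv]
    ring
  -- The case `v = 1`, reindexed from `Fin 1 → ℕ` to `ℕ`; the exponent is `n (n + 1) + n = n (n +
  -- 2)`.
  · have h := (Equiv.funUnique (Fin 1) ℕ).symm.hasSum_iff.mpr
      (hasSum_chainTerm_cubicBeta h0 hq1 0)
    convert h using 2 with n
    have e : tailSum (uniqueElim n : Fin 1 → ℕ) 0 = n := by simp [tailSum_zero]
    simp [chainTerm, cubicBeta, Equiv.funUnique, e]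
    ring
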